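/- Let $S$ be a finite alphabet. A \emph{cellular automaton} is a map $f:S^{\mathbb Z}\to S^{\mathbb Z}$ given by a local rule of some radius $r$, $f(x)_i=f_{\mathrm{loc}}(x_{i-r},\dots,x_{i+r})$. A \emph{bijective block rule} is a bijection $\chi:S^m\to S^m$ for some $m$; let $\xi=\chi^{-1}$. For $i\in\mathbb Z$ let $\chi^{i}:S^{\mathbb Z}\to S^{\mathbb Z}$ replace the word $x_{[i,i+m)}$ by $\chi(x_{[i,i+m)})$ and keep all other cells. Let $\chi^{i+}(x)=\lim_{j\to\infty}\chi^{j}\circ\cdots\circ\chi^{i+1}\circ\chi^{i}(x)$ and $\xi^{i-}(x)=\lim_{j\to-\infty}\xi^{j}\circ\cdots\circ\xi^{i-2}\circ\xi^{i-1}(x)$; these limits always exist in the product topology. The map $f$ is a \emph{slider} if there is a bijective block rule $\chi$ such that for all $y,z\in S^{\mathbb Z}$: $f(y)=z$ if and only if $\xi^{i-}(x)=y$ and $\chi^{i+}(x)=z$ for some $x\in S^{\mathbb Z}$ and some $i\in\mathbb Z$. The map $f$ is a \emph{sweeper} if there is a bijective block rule $\chi$ such that for every $y\in S^{\mathbb Z}$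 the limit $\lim_{i\to-\infty}\chi^{i+}(y)$ exists and equals $f(y)$. \textbf{Theorem.} A cellular automaton over a finite alphabet is a slider if and only if it is a sweeper. Moreover, it is decidable whether a given cellular automaton is a slider (equivalently, a sweeper): there is one algorithm (a total computable function) which, given the number of symbols, a radius and the table of values of a local rule of a cellular automaton $f$, decides whether $f$ is a slider, equivalently whether $f$ is a sweeper. -/

import Mathlib

open Filter Topology

/-- Bi-infinite configurations over the alphabet `S`. With `S` discrete, this type carries the
product topology generated by cylinders. -/
abbrev Config (S : Type*) := ℤ → S

/-- `f` is a (one-dimensional) cellular automaton: it is given by a local rule of some radius `r`,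
`f(x)_i = loc (x_{i-r}, …, x_{i+r})`. -/
def IsCellularAutomaton {S : Type*} (f : Config S → Config S) : Prop :=
  ∃ (r : ℕ) (loc : (Fin (2 * r + 1) → S) → S),
    ∀ (x : Config S) (i : ℤ), f x i = loc (fun j => x (i - (r : ℤ) + ((j : ℕ) : ℤ)))

/-- Application of the block rule `χ` at coordinate `i`: the word in `[i, i + m)` is replaced by
its image under `χ`, all other cells are kept. -/
def applyAt {S : Type*} {m : ℕ} (χ : (Fin m → S) → (Fin m → S)) (i : ℤ) (x : Config S) :
    Config S :=
  fun j =>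
    if h : i ≤ j ∧ j < i + (m : ℤ) then
      χ (fun k => x (i + ((k : ℕ) : ℤ))) ⟨(j - i).toNat, by omega⟩
    else x j

/-- Apply `χ` at the positions `i, i + 1, …, i + n - 1`, in this order. -/
def sweepRight {S : Type*} {m : ℕ} (χ : (Fin m → S) → (Fin m → S)) (i : ℤ) :
    ℕ → Config S → Config S
  | 0, x => x
  | n + 1, x => applyAt χ (i + (n : ℤ)) (sweepRight χ i n x)

/-- Apply `ξ` at the positions `i - 1, i - 2, …, i - n`, in this order. -/
def sweepLeft {S : Type*} {m : ℕ} (ξ : (Fin m → S) → (Fin m → S)) (i : ℤ) :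
    ℕ → Config S → Config S
  | 0, x => x
  | n + 1, x => applyAt ξ (i - ((n : ℤ) + 1)) (sweepLeft ξ i n x)

/-- The infinite left-to-right sweep `χ^{i+}(x)`, the limit of the finite sweeps
(see `tendsto_sweepRight`). The value of cell `p` is final once the rule has been applied at all
positions in `[i, p]`. -/
def toRight {S : Type*} {m : ℕ} (χ : (Fin m → S) → (Fin m → S)) (i : ℤ) (x : Config S) :
    Config S :=
  fun p => sweepRight χ i (p - i + 1).toNat x p

/-- The infinite right-to-left sweep `ξ^{i-}(x)`, the limit of the finite sweeps
(see `tendsto_sweepLeft`). The value of cell `p` is final once the rule has been applied at all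
positions in `[p - m, i)`. -/
def toLeft {S : Type*} {m : ℕ} (ξ : (Fin m → S) → (Fin m → S)) (i : ℤ) (x : Config S) :
    Config S :=
  fun p => sweepLeft ξ i (i - p + (m : ℤ)).toNat x p

theorem sweepRight_stable {S : Type*} {m : ℕ} (χ : (Fin m → S) → (Fin m → S)) (i : ℤ)
    (x : Config S) (p : ℤ) (n : ℕ) (hn : (p - i + 1).toNat ≤ n) :
    sweepRight χ i n x p = toRight χ i x p := by
  induction n, hn using Nat.le_induction with
  | base => rfl
  | succ n hn ih =>
    rw [← ih]
    have h : ¬ (i + (n : ℤ) ≤ p ∧ p < i + (n : ℤ) + (m : ℤ)) := by omega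
    simp only [sweepRight, applyAt, dif_neg h]

theorem sweepLeft_stable {S : Type*} {m : ℕ} (ξ : (Fin m → S) → (Fin m → S)) (i : ℤ)
    (x : Config S) (p : ℤ) (n : ℕ) (hn : (i - p + (m : ℤ)).toNat ≤ n) :
    sweepLeft ξ i n x p = toLeft ξ i x p := by
  induction n, hn using Nat.le_induction with
  | base => rfl
  | succ n hn ih =>
    rw [← ih]
    have h : ¬ (i - ((n : ℤ) + 1) ≤ p ∧ p < i - ((n : ℤ) + 1) + (m : ℤ)) := by omega
    simp only [sweepLeft, applyAt, dif_neg h]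

theorem tendsto_sweepRight {S : Type*} [TopologicalSpace S] {m : ℕ}
    (χ : (Fin m → S) → (Fin m → S)) (i : ℤ) (x : Config S) :
    Tendsto (fun n => sweepRight χ i n x) atTop (𝓝 (toRight χ i x)) := by
  refine tendsto_pi_nhds.2 fun p => tendsto_const_nhds.congr' ?_
  filter_upwards [eventually_ge_atTop (p - i + 1).toNat] with n hn
  exact (sweepRight_stable χ i x p n hn).symm

theorem tendsto_sweepLeft {S : Type*} [TopologicalSpace S] {m : ℕ}
    (ξ : (Fin m → S) → (Fin m → S)) (i : ℤ) (x : Config S) :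
    Tendsto (fun n => sweepLeft ξ i n x) atTop (𝓝 (toLeft ξ i x)) := by
  refine tendsto_pi_nhds.2 fun p => tendsto_const_nhds.congr' ?_
  filter_upwards [eventually_ge_atTop (i - p + (m : ℤ)).toNat] with n hn
  exact (sweepLeft_stable ξ i x p n hn).symm

/-- The slider relation of a bijective block rule `χ` with inverse `ξ = χ.symm`:
`(y, z)` is in it iff `ξ^{i-}(x) = y` and `χ^{i+}(x) = z` for some configuration `x` and some
position `i`. -/
def SliderRel {S : Type*} {m : ℕ} (χ : Equiv.Perm (Fin m → S)) (y z : Config S) : Prop :=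
  ∃ (x : Config S) (i : ℤ), toLeft χ.symm i x = y ∧ toRight χ i x = z

/-- `f` is a slider: the slider relation of some bijective block rule is (the graph of) `f`. -/
def IsSlider {S : Type*} (f : Config S → Config S) : Prop :=
  ∃ (m : ℕ) (χ : Equiv.Perm (Fin m → S)), ∀ y z : Config S, SliderRel χ y z ↔ f y = z

/-- The block rule `χ` defines `f` as a sweeper: for each configuration `y`, the limit of
`χ^{i+}(y)` as `i → -∞` exists and equals `f(y)`. -/
def DefinesSweeper {S : Type*} [TopologicalSpace S] {m : ℕ} (χ : (Fin m → S) → (Fin m → S))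
    (f : Config S → Config S) : Prop :=
  ∀ y : Config S, Tendsto (fun i : ℤ => toRight χ i y) atBot (𝓝 (f y))

/-- `f` is a sweeper: it is the sweeper defined by some bijective block rule. -/
def IsSweeper {S : Type*} [TopologicalSpace S] (f : Config S → Config S) : Prop :=
  ∃ (m : ℕ) (χ : Equiv.Perm (Fin m → S)), DefinesSweeper χ f

/-- Finite descriptions of cellular automata, as inputs of algorithms: number of symbols, radius,
and the value table of the local rule. -/
abbrev CACode := ℕ × ℕ × List ℕ

/-- The code `c = (s, r, T)` presents `f`: after numbering the alphabet by `0, …, s - 1`, the map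
`f` has radius `r` and the table `T` lists the values of its local rule. The entry for the word
`a_0 ⋯ a_{2r}` is at index `∑ j, a_j * s ^ j` (this is `finFunctionFinEquiv`). -/
def CACode.Presents {S : Type*} (c : CACode) (f : Config S → Config S) : Prop :=
  ∃ e : S ≃ Fin c.1, ∀ (x : Config S) (i : ℤ),
    c.2.2[((finFunctionFinEquiv (fun j : Fin (2 * c.2.1 + 1) =>
      e (x (i - (c.2.1 : ℤ) + ((j : ℕ) : ℤ)))) : Fin (c.1 ^ (2 * c.2.1 + 1))) : ℕ)]?
      = some ((e (f x i) : Fin c.1) : ℕ)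

/-- Over a finite alphabet, the maps that are presented by a code are exactly the cellular
automata. -/
theorem isCellularAutomaton_iff_exists_code {S : Type*} [Finite S] (f : Config S → Config S) :
    IsCellularAutomaton f ↔ ∃ c : CACode, c.Presents f := by
  constructor
  · rintro ⟨r, loc, h⟩
    obtain ⟨s, ⟨e⟩⟩ := Finite.exists_equiv_fin S
    refine ⟨(s, r, List.ofFn fun w : Fin (s ^ (2 * r + 1)) =>
      ((e (loc fun j => e.symm (finFunctionFinEquiv.symm w j)) : Fin s) : ℕ)), e, ?_⟩
    intro x i
    have hlt := (finFunctionFinEquiv (fun j : Fin (2 * r + 1) =>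
      e (x (i - (r : ℤ) + ((j : ℕ) : ℤ))))).isLt
    rw [List.getElem?_ofFn, dif_pos hlt]
    simp only [Fin.eta, Equiv.symm_apply_apply, h x i]
  · rintro ⟨⟨s, r, T⟩, e, h⟩
    rcases isEmpty_or_nonempty S with hS | ⟨⟨a⟩⟩
    · exact ⟨r, fun w => w 0, fun x => (hS.false (x 0)).elim⟩
    refine ⟨r, fun w => f (fun k => if hk : -(r : ℤ) ≤ k ∧ k ≤ r then
      w ⟨(k + r).toNat, by omega⟩ else a) 0, fun x i => ?_⟩
    apply e.injective
    apply Fin.val_injective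
    apply Option.some_injective
    rw [← h, ← h]
    congr 3
    funext j
    have hj := j.isLt
    simp only at hj
    have h1 : -(r : ℤ) ≤ 0 - (r : ℤ) + ((j : ℕ) : ℤ) ∧ 0 - (r : ℤ) + ((j : ℕ) : ℤ) ≤ r := by omega
    have h2 : (0 - (r : ℤ) + ((j : ℕ) : ℤ) + r).toNat = j := by omega
    simp only [dif_pos h1, h2]

/-! A run is the two-way infinite sequence of configurations obtained by applying `χ` at successive
positions. Its two diagonals, the cells before and after they are rewritten, are the left and right
sweeps from any of its configurations (`IsRun.toLeft_eq`, `IsRun.toRight_eq`), so a slider sends the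
first diagonal to the second. A slider is a sweeper because a left sweep from `i` does not touch the
cells from `i + m` on. Conversely, a sweeper converges uniformly (`DefinesSweeper.toRight_eq`):
finite sweeps preserve the uniform Bernoulli measure, so the clopen error set has constant measure
far to the left, while pointwise convergence forces that measure to 0. By compactness every
configuration is a first diagonal (`surjective_toLeft`).

For decidability, finitely many stairs serve as the states of a transducer that reads `y` and writes
`f y`. With `B = |S| ^ (4 r)`, `f` is a slider iff this transducer is bijective (`LeftClosing`) and
the number of stairs divides `|S| ^ (B + r)` (`isSlider_iff`). If so, a word of length `B + r`
amounts to a stair and an inert label, and the transducer becomes a block rule. Conversely, a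
slider's block rule maps words to stairs compatibly with the transducer, and all fibres have the
same size; this needs long stairs, and pumping descends to `B`. Bijectivity is itself a count,
`#stairs (B + 1) = |S| * #stairs B`, so the criterion is primitive recursive in the code. -/

section Runs

/-! ### Runs of a block rule and their diagonals. -/

variable {S : Type*} {m : ℕ}

theorem applyAt_of_notMem (χ : (Fin m → S) → (Fin m → S)) {i p : ℤ} (x : Config S)
    (h : ¬ (i ≤ p ∧ p < i + (m : ℤ))) : applyAt χ i x p = x p := by
  simp only [applyAt, dif_neg h]

theorem applyAt_block (χ : (Fin m → S) → (Fin m → S)) (i : ℤ) (x : Config S) (k : Fin m) :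
    applyAt χ i x (i + ((k : ℕ) : ℤ)) = χ (fun k => x (i + ((k : ℕ) : ℤ))) k := by
  have h : i ≤ i + ((k : ℕ) : ℤ) ∧ i + ((k : ℕ) : ℤ) < i + (m : ℤ) := by omega
  simp only [applyAt, dif_pos h]
  congr 1
  ext
  simp

/-- If `φ` is a left inverse of `ψ`, then so it is when both are applied at the same position. -/
theorem applyAt_applyAt {φ ψ : (Fin m → S) → (Fin m → S)} (h : ∀ w, φ (ψ w) = w) (i : ℤ)
    (x : Config S) : applyAt φ i (applyAt ψ i x) = x := by
  funext p
  by_cases hp : i ≤ p ∧ p < i + (m : ℤ)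
  · obtain ⟨k, rfl⟩ : ∃ k : Fin m, p = i + ((k : ℕ) : ℤ) :=
      ⟨⟨(p - i).toNat, by omega⟩, by simp only; omega⟩
    rw [applyAt_block]
    simp only [applyAt_block, h]
  · rw [applyAt_of_notMem _ _ hp, applyAt_of_notMem _ _ hp]

theorem applyAt_symm_apply (χ : Equiv.Perm (Fin m → S)) (i : ℤ) (x : Config S) :
    applyAt χ.symm i (applyAt χ i x) = x :=
  applyAt_applyAt χ.symm_apply_apply i x

theorem applyAt_apply_symm (χ : Equiv.Perm (Fin m → S)) (i : ℤ) (x : Config S) :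
    applyAt χ i (applyAt χ.symm i x) = x :=
  applyAt_applyAt χ.apply_symm_apply i x

/-- Agreement of two configurations on a region that contains the block is preserved. -/
theorem applyAt_congr (χ : (Fin m → S) → (Fin m → S)) {i : ℤ} {x x' : Config S} (A : ℤ → Prop)
    (hA : ∀ p, i ≤ p → p < i + (m : ℤ) → A p) (h : ∀ p, A p → x p = x' p) (p : ℤ) (hp : A p) :
    applyAt χ i x p = applyAt χ i x' p := by
  have hw : (fun k : Fin m => x (i + ((k : ℕ) : ℤ))) = fun k : Fin m => x' (i + ((k : ℕ) : ℤ)) :=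
    funext fun k => h _ (hA _ (by omega) (by omega))
  simp only [applyAt, hw, h p hp]

theorem applyAt_shift (χ : (Fin m → S) → (Fin m → S)) (i t : ℤ) (x : Config S) :
    applyAt χ i (fun p => x (p + t)) = fun p => applyAt χ (i + t) x (p + t) := by
  funext p
  by_cases hp : i ≤ p ∧ p < i + (m : ℤ)
  · obtain ⟨k, rfl⟩ : ∃ k : Fin m, p = i + ((k : ℕ) : ℤ) :=
      ⟨⟨(p - i).toNat, by omega⟩, by simp only; omega⟩
    rw [applyAt_block, add_right_comm, applyAt_block]
    simp only [add_right_comm]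
  · rw [applyAt_of_notMem _ _ hp, applyAt_of_notMem _ _ (by omega)]

/-- A run of the block rule: `X (j + 1)` arises from `X j` by applying `χ` at position `j`. -/
def IsRun (χ : (Fin m → S) → (Fin m → S)) (X : ℤ → Config S) : Prop :=
  ∀ j, X (j + 1) = applyAt χ j (X j)

/-- Invertibility of `χ` allows the run to be continued backwards in time. -/
theorem exists_isRun (χ : Equiv.Perm (Fin m → S)) (i : ℤ) (x : Config S) :
    ∃ X, IsRun χ X ∧ X i = x := by
  refine ⟨fun j => if i ≤ j then sweepRight χ i (j - i).toNat x
    else sweepLeft χ.symm i (i - j).toNat x, fun j => ?_, by simp [sweepRight]⟩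
  by_cases h : i ≤ j
  · have h1 : (j + 1 - i).toNat = (j - i).toNat + 1 := by omega
    have h2 : i + ((j - i).toNat : ℤ) = j := by omega
    simp only [h, if_true, show i ≤ j + 1 by omega, h1, sweepRight, h2]
  · have h1 : (i - j).toNat = (i - (j + 1)).toNat + 1 := by omega
    have h2 : i - (((i - (j + 1)).toNat : ℤ) + 1) = j := by omega
    simp only [h, if_false, h1, sweepLeft, h2, applyAt_apply_symm]
    split_ifs with h3
    · have h4 : j + 1 = i := by omega
      simp [h4, sweepRight, sweepLeft]
    · rfl

namespace IsRun

theorem sweepRight_eq {χ : (Fin m → S) → (Fin m → S)} {X : ℤ → Config S} (h : IsRun χ X) (i : ℤ)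
    (n : ℕ) : sweepRight χ i n (X i) = X (i + n) := by
  induction n with
  | zero => simp [sweepRight]
  | succ n ih => rw [sweepRight, ih, ← h]; push_cast; rw [add_assoc]

theorem sweepLeft_eq {χ : Equiv.Perm (Fin m → S)} {X : ℤ → Config S} (h : IsRun χ X) (i : ℤ)
    (n : ℕ) : sweepLeft χ.symm i n (X i) = X (i - n) := by
  induction n with
  | zero => simp [sweepLeft]
  | succ n ih =>
    have h1 : X (i - n) = applyAt χ (i - (n + 1)) (X (i - (n + 1))) := by
      rw [← h]; congr 1; ring
    rw [sweepLeft, ih, h1, applyAt_symm_apply]; push_cast; rfl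

/-- Cell `p` is rewritten only at positions in `(p - m, p]`. Hence it is frozen after position `p`,
and, in `eq_of_add_le`, still original up to position `p - m`. -/
theorem eq_of_lt {χ : (Fin m → S) → (Fin m → S)} {X : ℤ → Config S} (h : IsRun χ X) {p j : ℤ}
    (hj : p < j) : X j p = X (p + 1) p := by
  induction j, (show p + 1 ≤ j by omega) using Int.leInduction with
  | base => rfl
  | succ j hj' ih => rw [h, applyAt_of_notMem _ _ (by omega), ih (by omega)]

theorem eq_of_add_le {χ : (Fin m → S) → (Fin m → S)} {X : ℤ → Config S} (h : IsRun χ X) {p j : ℤ}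
    (hj : j + m ≤ p) : X j p = X (p - m) p := by
  induction j, (show j ≤ p - m by omega) using Int.leInductionDown with
  | base => rfl
  | pred j hj' ih =>
    rw [← ih (by omega)]
    conv_rhs => rw [← sub_add_cancel j 1, h]
    rw [applyAt_of_notMem _ _ (by omega)]

theorem toRight_eq {χ : (Fin m → S) → (Fin m → S)} {X : ℤ → Config S} (h : IsRun χ X) (i : ℤ) :
    toRight χ i (X i) = fun p => X (p + 1) p := by
  funext p
  rw [toRight, h.sweepRight_eq, h.eq_of_lt (by omega)]

theorem toLeft_eq {χ : Equiv.Perm (Fin m → S)} {X : ℤ → Config S} (h : IsRun χ X) (i : ℤ) :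
    toLeft χ.symm i (X i) = fun p => X (p - m) p := by
  funext p
  rw [toLeft, h.sweepLeft_eq, h.eq_of_add_le (by omega)]

theorem shift {χ : (Fin m → S) → (Fin m → S)} {X : ℤ → Config S} (h : IsRun χ X) (t : ℤ) :
    IsRun χ fun j p => X (j + t) (p + t) := by
  intro j
  rw [applyAt_shift, ← h, add_right_comm]

end IsRun

theorem sliderRel_iff (χ : Equiv.Perm (Fin m → S)) (y z : Config S) :
    SliderRel χ y z ↔
      ∃ X, IsRun χ X ∧ (∀ p, X (p - m) p = y p) ∧ ∀ p, X (p + 1) p = z p := by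
  constructor
  · rintro ⟨x, i, rfl, rfl⟩
    obtain ⟨X, hX, rfl⟩ := exists_isRun χ i x
    refine ⟨X, hX, fun p => ?_, fun p => ?_⟩
    · rw [hX.toLeft_eq]
    · rw [hX.toRight_eq]
  · rintro ⟨X, hX, hy, hz⟩
    refine ⟨X 0, 0, ?_, ?_⟩
    · rw [hX.toLeft_eq]; exact funext hy
    · rw [hX.toRight_eq]; exact funext hz

end Runs

/-! ### Local maps; sliders are sweepers. -/

/-- `f` commutes with the shift and is determined by windows of radius `r`. -/
structure IsSlidingMap {S : Type*} (f : Config S → Config S) (r : ℕ) : Prop where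
  congr : ∀ (x y : Config S) (i : ℤ), (∀ p, i - r ≤ p → p ≤ i + r → x p = y p) → f x i = f y i
  shift : ∀ (x : Config S) (t i : ℤ), f (fun p => x (p + t)) i = f x (i + t)

theorem isSlidingMap_of_local {S : Type*} {f : Config S → Config S} {r : ℕ}
    {loc : (Fin (2 * r + 1) → S) → S}
    (h : ∀ (x : Config S) (i : ℤ), f x i = loc (fun j => x (i - (r : ℤ) + ((j : ℕ) : ℤ)))) :
    IsSlidingMap f r where
  congr x y i hxy := by
    rw [h, h]
    congr 1
    funext j
    exact hxy _ (by omega) (by omega)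
  shift x t i := by
    rw [h, h]
    congr 1
    funext j
    congr 1
    ring

/-- The left sweep from `i` of `y` agrees with `y` from cell `i + m` on. Once `i ≤ p - r - m`, this
covers the window that determines cell `p` of the image. -/
theorem IsSlider.isSweeper {S : Type*} [TopologicalSpace S] {f : Config S → Config S} {r : ℕ}
    (hf : IsSlidingMap f r) (h : IsSlider f) : IsSweeper f := by
  obtain ⟨m, χ, h⟩ := h
  refine ⟨m, χ, fun y => tendsto_pi_nhds.2 fun p => tendsto_const_nhds.congr' ?_⟩
  filter_upwards [eventually_le_atBot (p - r - m)] with i hi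
  have h1 : f (toLeft χ.symm i y) = toRight χ i y := (h _ _).1 ⟨y, i, rfl, rfl⟩
  rw [← h1]
  refine hf.congr _ _ _ fun q hq _ => ?_
  obtain ⟨X, hX, rfl⟩ := exists_isRun χ i y
  rw [hX.toLeft_eq, hX.eq_of_add_le (by omega)]

/-! ### Continuity of sweeps and compactness. -/

section Continuity

variable {S : Type*} {m : ℕ} [TopologicalSpace S] [DiscreteTopology S]

theorem continuous_applyAt [Finite S] (χ : (Fin m → S) → (Fin m → S)) (i : ℤ) :
    Continuous (applyAt χ i) := by
  refine continuous_pi fun p => ?_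
  by_cases h : i ≤ p ∧ p < i + (m : ℤ)
  · simp only [applyAt, dif_pos h]
    exact (continuous_of_discreteTopology
      (f := fun w : Fin m → S => χ w ⟨(p - i).toNat, by omega⟩)).comp
      (continuous_pi fun k => continuous_apply _)
  · simp only [applyAt, dif_neg h]
    exact continuous_apply p

theorem continuous_sweepRight [Finite S] (χ : (Fin m → S) → (Fin m → S)) (i : ℤ) (n : ℕ) :
    Continuous (sweepRight χ i n) := by
  induction n with
  | zero => exact continuous_id
  | succ n ih => exact (continuous_applyAt χ _).comp ih

theorem continuous_sweepLeft [Finite S] (χ : (Fin m → S) → (Fin m → S)) (i : ℤ) (n : ℕ) :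
    Continuous (sweepLeft χ i n) := by
  induction n with
  | zero => exact continuous_id
  | succ n ih => exact (continuous_applyAt χ _).comp ih

theorem continuous_toRight [Finite S] (χ : (Fin m → S) → (Fin m → S)) (i : ℤ) :
    Continuous (toRight χ i) :=
  continuous_pi fun p => (continuous_apply p).comp (continuous_sweepRight χ i _)

theorem continuous_toLeft [Finite S] (χ : (Fin m → S) → (Fin m → S)) (i : ℤ) :
    Continuous (toLeft χ i) :=
  continuous_pi fun p => (continuous_apply p).comp (continuous_sweepLeft χ i _)

theorem IsSlidingMap.continuous [Nonempty S] {f : Config S → Config S} {r : ℕ}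
    (hf : IsSlidingMap f r) : Continuous f := by
  refine continuous_pi fun p => ?_
  have h : (fun x => f x p) = (fun w : Fin (2 * r + 1) → S =>
      f (fun q => if h : p - r ≤ q ∧ q ≤ p + r then w ⟨(q - (p - r)).toNat, by omega⟩
        else Classical.arbitrary S) p) ∘ fun (x : Config S) j => x (p - r + ((j : ℕ) : ℤ)) := by
    funext x
    refine hf.congr _ _ _ fun q h1 h2 => ?_
    simp only [dif_pos (And.intro h1 h2)]
    congr 1
    omega
  rw [h]
  exact continuous_of_discreteTopology.comp (continuous_pi fun j => continuous_apply _)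

/-- Every configuration is the left limit of some run. -/
theorem surjective_toLeft [Finite S] (χ : Equiv.Perm (Fin m → S)) (i : ℤ) :
    Function.Surjective (toLeft χ.symm i) := by
  intro y
  let K : ℕ → Set (Config S) := fun n => {x | ∀ p, i - n ≤ p → toLeft χ.symm i x p = y p}
  have hK : ∀ n, IsClosed (K n) := fun n => by
    simp only [K, Set.ofPred_forall]
    exact isClosed_iInter fun p => isClosed_iInter fun _ =>
      isClosed_eq ((continuous_apply p).comp (continuous_toLeft _ i)) continuous_const
  obtain ⟨x, hx⟩ := IsCompact.nonempty_iInter_of_sequence_nonempty_isCompact_isClosed K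
    (fun n x hx p hp => hx p (by push_cast; omega))
    (fun n => by
      -- A run started from `y` at `i - n - m` has not yet changed the cells from `i - n` on, so its
      -- first diagonal agrees with `y` there.
      obtain ⟨X, hX, h⟩ := exists_isRun χ (i - n - m) y
      refine ⟨X i, fun p hp => ?_⟩
      simp only [hX.toLeft_eq]
      rw [← hX.eq_of_add_le (j := i - n - m) (by omega), h])
    (hK 0).isCompact hK
  refine ⟨x, funext fun p => ?_⟩
  exact Set.mem_iInter.1 hx (i - p).toNat p (by omega)

end Continuity

/-! ### Invariance of the uniform Bernoulli measure. -/

section UniformMeasure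

open MeasureTheory

variable (S : Type*) [Finite S] [Nonempty S] [MeasurableSpace S] [MeasurableSingletonClass S]

/-- The uniform Bernoulli measure on configurations. -/
noncomputable def bernoulliMeasure : Measure (Config S) :=
  Measure.infinitePi fun _ => ProbabilityTheory.uniformOn Set.univ

instance : IsProbabilityMeasure (ProbabilityTheory.uniformOn (Set.univ : Set S)) :=
  ProbabilityTheory.isProbabilityMeasure_uniformOn Set.finite_univ Set.univ_nonempty

instance : IsProbabilityMeasure (bernoulliMeasure S) := by
  unfold bernoulliMeasure; infer_instance

variable {S}

theorem bernoulliMeasure_cylinder (J : Finset ℤ) (u : Config S) :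
    bernoulliMeasure S {x | ∀ p ∈ J, x p = u p} = ((Nat.card S : ENNReal)⁻¹) ^ J.card := by
  have h : {x : Config S | ∀ p ∈ J, x p = u p} = Set.pi J fun p => {u p} := by
    ext x; simp [Set.mem_pi]
  have : Fintype S := Fintype.ofFinite S
  rw [h, bernoulliMeasure, Measure.infinitePi_pi _ fun p _ => measurableSet_singleton _]
  simp [ProbabilityTheory.uniformOn_univ]

/-- Over a finite set of cells containing the block, `applyAt χ i` permutes the cylinders, and these
all have the same measure. -/
theorem measurePreserving_applyAt {m : ℕ}
    (χ : Equiv.Perm (Fin m → S)) (i : ℤ) (hm : Measurable (applyAt χ i)) :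
    MeasurePreserving (applyAt χ i) (bernoulliMeasure S) (bernoulliMeasure S) := by
  classical
  have : Fintype S := Fintype.ofFinite S
  refine ⟨hm, ?_⟩
  nth_rewrite 2 [bernoulliMeasure]
  refine Measure.eq_infinitePi _ fun s t ht => ?_
  rw [← Measure.infinitePi_pi _ fun p _ => ht p, ← bernoulliMeasure]
  let J : Finset ℤ := s ∪ Finset.Ico i (i + m)
  let A : Finset (J → S) := Finset.univ.filter fun w =>
    ∀ (p : ℤ) (hp : p ∈ s), w ⟨p, Finset.mem_union_left _ hp⟩ ∈ t p
  have hA : Set.pi (s : Set ℤ) t = (J.restrict : Config S → J → S) ⁻¹' (A : Set (J → S)) := by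
    ext x; simp [A, Set.mem_pi, Finset.restrict]
  have hJ : Measurable (J.restrict : Config S → J → S) := Finset.measurable_restrict J
  have hsing : ∀ w : J → S, MeasurableSet ((J.restrict : Config S → J → S) ⁻¹' {w}) :=
    fun w => hJ (measurableSet_singleton w)
  rw [hA, ← sum_measure_preimage_singleton A fun w _ => hsing w,
    ← sum_measure_preimage_singleton A fun w _ => hsing w]
  refine Finset.sum_congr rfl fun w _ => ?_
  rw [Measure.map_apply hm (hsing w)]
  let u : Config S := fun p => if h : p ∈ J then w ⟨p, h⟩ else Classical.arbitrary S
  have h1 : (J.restrict : Config S → J → S) ⁻¹' {w} = {x | ∀ p ∈ J, x p = u p} := by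
    ext x
    simp only [Set.mem_preimage, Set.mem_singleton_iff, funext_iff, Subtype.forall,
      Finset.restrict, Set.mem_ofPred_eq]
    refine forall₂_congr fun p hp => ?_
    simp only [u, dif_pos hp]
  have hblock : ∀ p, i ≤ p → p < i + (m : ℤ) → p ∈ J := fun p h1 h2 =>
    Finset.mem_union_right _ (Finset.mem_Ico.2 ⟨h1, h2⟩)
  have h2 : applyAt χ i ⁻¹' {x | ∀ p ∈ J, x p = u p} =
      {x | ∀ p ∈ J, x p = applyAt χ.symm i u p} := by
    ext x
    simp only [Set.mem_preimage, Set.mem_ofPred_eq]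
    constructor
    · intro h p hp
      rw [← applyAt_symm_apply χ i x]
      exact applyAt_congr _ (· ∈ J) hblock h p hp
    · intro h p hp
      rw [← applyAt_apply_symm χ i u]
      exact applyAt_congr _ (· ∈ J) hblock h p hp
  rw [h1, h2, bernoulliMeasure_cylinder, bernoulliMeasure_cylinder]

theorem eq_empty_of_bernoulliMeasure_eq_zero [TopologicalSpace S] [DiscreteTopology S]
    {E : Set (Config S)} (hE : IsOpen E)
    (h : bernoulliMeasure S E = 0) : E = ∅ := by
  refine Set.eq_empty_of_forall_notMem fun x hx => ?_
  obtain ⟨J, u, hu, hJ⟩ := isOpen_pi_iff.1 hE x hx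
  have h0 := measure_mono_null (s := {y | ∀ p ∈ J, y p = x p}) (fun y hy => hJ fun p hp => by
    rw [hy p hp]; exact (hu p hp).2) h
  rw [bernoulliMeasure_cylinder] at h0
  exact pow_ne_zero _ (ENNReal.inv_ne_zero.2 (ENNReal.natCast_ne_top _)) h0

end UniformMeasure

/-! ### Uniform convergence of sweepers; sweepers are sliders. -/

section Sweeper

variable {S : Type*} [Finite S] [TopologicalSpace S] [DiscreteTopology S] {m : ℕ}

open MeasureTheory in
/-- The convergence of a sweeper is uniform. -/
theorem DefinesSweeper.toRight_eq {f : Config S → Config S} {r : ℕ} (hf : IsSlidingMap f r)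
    {χ : Equiv.Perm (Fin m → S)} (h : DefinesSweeper χ f) {i p : ℤ} (hi : i + m + r ≤ p)
    (x : Config S) : toRight χ i x p = f x p := by
  have : Nonempty S := ⟨x 0⟩
  borelize S
  have hmeas : ∀ j, MeasurePreserving (applyAt χ j) (bernoulliMeasure S) (bernoulliMeasure S) :=
    fun j => measurePreserving_applyAt χ j (continuous_applyAt χ j).measurable
  have hsweep : ∀ j n,
      MeasurePreserving (sweepRight χ j n) (bernoulliMeasure S) (bernoulliMeasure S) := by
    intro j n
    induction n with
    | zero => exact MeasurePreserving.id _
    | succ n ih => exact (hmeas _).comp ih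
  let E : ℤ → Set (Config S) := fun j => {x | toRight χ j x p ≠ f x p}
  have hE : ∀ j, IsClopen (E j) := fun j => by
    have hc : Continuous fun x => (toRight χ j x p, f x p) :=
      ((continuous_apply p).comp (continuous_toRight χ j)).prodMk
        ((continuous_apply p).comp hf.continuous)
    exact (isClopen_discrete {q : S × S | q.1 ≠ q.2}).preimage hc
  -- Sweeping from `j` to `i` stays on the same run, so the second diagonal is unchanged; it affects
  -- only cells below `i + m`, outside the window of `p`.
  have hpre : ∀ j, j ≤ i → E j = sweepRight χ j (i - j).toNat ⁻¹' E i := by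
    intro j hj
    ext x
    obtain ⟨X, hX, rfl⟩ := exists_isRun χ j x
    have h1 : j + ((i - j).toNat : ℤ) = i := by omega
    have h2 : f (X j) p = f (X i) p := hf.congr _ _ _ fun q hq _ => by
      rw [hX.eq_of_add_le (p := q) (j := j) (by omega), hX.eq_of_add_le (p := q) (j := i) (by omega)]
    simp only [E, Set.mem_preimage, Set.mem_ofPred_eq, hX.sweepRight_eq, h1, hX.toRight_eq, h2]
  have hconst : ∀ j, j ≤ i → bernoulliMeasure S (E j) = bernoulliMeasure S (E i) := by
    intro j hj
    rw [hpre j hj]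
    exact (hsweep _ _).measure_preimage (hE i).isOpen.measurableSet.nullMeasurableSet
  have hlim : Tendsto (fun j => bernoulliMeasure S (E j)) atBot
      (𝓝 (bernoulliMeasure S (∅ : Set (Config S)))) := by
    refine tendsto_measure_of_ae_tendsto_indicator_of_isFiniteMeasure atBot MeasurableSet.empty
      (fun j => (hE j).isOpen.measurableSet) (ae_of_all _ fun x => ?_)
    have h1 := tendsto_pi_nhds.1 (h x) p
    rw [nhds_discrete, tendsto_pure] at h1
    filter_upwards [h1] with j hj
    simp [E, hj]
  have hzero : bernoulliMeasure S (E i) = 0 := by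
    rw [measure_empty] at hlim
    refine tendsto_nhds_unique (tendsto_const_nhds.congr' ?_) hlim
    filter_upwards [eventually_le_atBot i] with j hj
    exact (hconst j hj).symm
  by_contra hx
  exact (Set.eq_empty_iff_forall_notMem.1
    (eq_empty_of_bernoulliMeasure_eq_zero (hE i).isOpen hzero)) x hx

theorem IsSweeper.isSlider {f : Config S → Config S} {r : ℕ} (hf : IsSlidingMap f r)
    (h : IsSweeper f) : IsSlider f := by
  obtain ⟨m, χ, h⟩ := h
  have key : ∀ i x, toRight χ i x = f (toLeft χ.symm i x) := by
    intro i x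
    funext p
    obtain ⟨X, hX, rfl⟩ := exists_isRun χ i x
    have h1 := h.toRight_eq hf (i := p - r - m) (p := p) (by omega) (X (p - r - m))
    rw [hX.toRight_eq, hX.toLeft_eq]
    rw [hX.toRight_eq] at h1
    rw [h1]
    exact hf.congr _ _ _ fun q hq _ => hX.eq_of_add_le (by omega)
  refine ⟨m, χ, fun y z => ⟨?_, ?_⟩⟩
  · rintro ⟨x, i, rfl, rfl⟩
    exact (key i x).symm
  · rintro rfl
    obtain ⟨x, rfl⟩ := surjective_toLeft χ 0 y
    exact ⟨x, 0, rfl, key 0 x⟩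

end Sweeper

/-! ### Counting with maps between finite sets. -/

section Finite

theorem Function.Surjective.exists_factor {Y A B : Type*} {α : Y → A} {β : Y → B}
    (hα : Function.Surjective α) (h : ∀ y y', α y = α y' → β y = β y') :
    ∃ T : A → B, ∀ y, T (α y) = β y :=
  ⟨fun a => β (Function.surjInv hα a), fun y => h _ _ (Function.surjInv_eq hα (α y))⟩

/-- The induced map `A → B` is onto between equinumerous finite sets, hence injective. -/
theorem eq_of_eq_of_surjective {Y A B : Type*} [Finite A] (e : A ≃ B) {α : Y → A} {β : Y → B}
    (hα : Function.Surjective α) (hβ : Function.Surjective β)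
    (h : ∀ y y', α y = α y' → β y = β y') {y y' : Y} (hy : β y = β y') : α y = α y' := by
  obtain ⟨T, hT⟩ := hα.exists_factor h
  have hs : Function.Surjective T := fun b => by
    obtain ⟨y, rfl⟩ := hβ b
    exact ⟨_, hT y⟩
  exact (Finite.injective_iff_surjective_of_equiv e).2 hs (by rw [hT, hT, hy])

theorem exists_equiv_of_eq_iff_eq {Y A B : Type*} [Finite A] (e : A ≃ B) {α : Y → A} {β : Y → B}
    (hα : Function.Surjective α) (h : ∀ y y', α y = α y' ↔ β y = β y') :
    ∃ T : A ≃ B, ∀ y, T (α y) = β y := by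
  obtain ⟨T, hT⟩ := hα.exists_factor fun y y' => (h y y').1
  have hi : Function.Injective T := fun a a' haa => by
    obtain ⟨y, rfl⟩ := hα a
    obtain ⟨y', rfl⟩ := hα a'
    rw [hT, hT] at haa
    exact (h y y').2 haa
  exact ⟨Equiv.ofBijective T ⟨hi, (Finite.injective_iff_surjective_of_equiv e).1 hi⟩, hT⟩

theorem natCard_range_eq {Y A B : Type*} {α : Y → A} {β : Y → B}
    (h : ∀ y y', α y = α y' ↔ β y = β y') :
    Nat.card (Set.range α) = Nat.card (Set.range β) := by
  have hk : Setoid.ker α = Setoid.ker β := Setoid.ext h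
  rw [← Nat.card_congr (Setoid.quotientKerEquivRange α),
    ← Nat.card_congr (Setoid.quotientKerEquivRange β), hk]

/-- Fibres of a quotient map between bijective transducers are preserved along transitions. -/
theorem natCard_fiber_eq {Q P S : Type*} (U : Q × S ≃ S × Q) (T : P × S ≃ S × P) (π : Q → P)
    (h : ∀ q c, T (π q, c) = ((U (q, c)).1, π (U (q, c)).2)) {p p' : P} {a c : S}
    (hp : T (p, c) = (a, p')) : Nat.card {q // π q = p} = Nat.card {q // π q = p'} := by
  have hU : ∀ q, π q = p → (U (q, c)).1 = a ∧ π (U (q, c)).2 = p' := by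
    rintro q rfl
    rw [h, Prod.mk.injEq] at hp
    exact hp
  have hU' : ∀ q', π q' = p' → (U.symm (a, q')).2 = c ∧ π (U.symm (a, q')).1 = p := by
    rintro q' rfl
    have h1 := h (U.symm (a, q')).1 (U.symm (a, q')).2
    rw [Prod.mk.eta, Equiv.apply_symm_apply, ← hp, T.apply_eq_iff_eq, Prod.mk.injEq] at h1
    exact ⟨h1.2, h1.1⟩
  refine Nat.card_congr ⟨fun q => ⟨(U (q.1, c)).2, (hU q q.2).2⟩,
    fun q => ⟨(U.symm (a, q.1)).1, (hU' q q.2).2⟩, fun q => ?_, fun q => ?_⟩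
  · apply Subtype.ext
    have h1 : (a, (U (q.1, c)).2) = U (q.1, c) := by rw [← (hU q q.2).1]
    simp only [h1, Equiv.symm_apply_apply]
  · apply Subtype.ext
    have h1 : ((U.symm (a, q.1)).1, c) = U.symm (a, q.1) := by rw [← (hU' q q.2).1]
    simp only [h1, Equiv.apply_symm_apply]

end Finite

/-! ### Stairs, their transducer, and left closing. -/

section Stairs

variable {S : Type*}

/-- The shift of a configuration by `t`. -/
def shiftBy (t : ℤ) (y : Config S) : Config S := fun p => y (p + t)

/-- The stair of `y`: the cells `0, …, M - 1` of `f y` followed by the cells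
`M - r, …, M + r - 1` of `y`. -/
def stair (f : Config S → Config S) (r M : ℕ) (y : Config S) : Fin (M + 2 * r) → S :=
  fun i => if (i : ℕ) < M then f y (i : ℕ) else y ((i : ℕ) - r)

/-- The set of all stairs. -/
def stairs (f : Config S → Config S) (r M : ℕ) : Set (Fin (M + 2 * r) → S) :=
  Set.range (stair f r M)

/-- A stair as an element of the set of all stairs. -/
def toStairs (f : Config S → Config S) (r M : ℕ) (y : Config S) : stairs f r M :=
  ⟨stair f r M y, y, rfl⟩

/-- A cell of `y` is determined by the next `2 r` cells of `y` and by `M + 1` cells of `f y`. -/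
def LeftClosing (f : Config S → Config S) (r M : ℕ) : Prop :=
  ∀ y y' : Config S, (∀ p : ℤ, 0 ≤ p → p ≤ M → f y p = f y' p) →
    (∀ p : ℤ, (M : ℤ) - r < p → p ≤ M + r → y p = y' p) → y (M - r) = y' (M - r)

/-- A stair and the next input cell. -/
def stairIn (f : Config S → Config S) (r M : ℕ) (y : Config S) : stairs f r M × S :=
  (toStairs f r M y, y (M + r))

/-- The output cell and the stair at the next position. -/
def stairOut (f : Config S → Config S) (r M : ℕ) (y : Config S) : S × stairs f r M :=
  (f y 0, toStairs f r M (shiftBy 1 y))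

variable {f : Config S → Config S} {r M : ℕ}

theorem stair_eq_iff {y y' : Config S} : stair f r M y = stair f r M y' ↔
    (∀ p : ℤ, 0 ≤ p → p < M → f y p = f y' p) ∧
      ∀ p : ℤ, (M : ℤ) - r ≤ p → p < M + r → y p = y' p := by
  constructor
  · intro h
    refine ⟨fun p h0 h1 => ?_, fun p h0 h1 => ?_⟩
    · have := congrFun h ⟨p.toNat, by omega⟩
      simpa [stair, show p.toNat < M by omega, h0] using this
    · have := congrFun h ⟨(p + r).toNat, by omega⟩
      have h2 : ((p + r).toNat : ℤ) - r = p := by omega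
      simpa only [stair, show ¬ (p + r).toNat < M by omega, if_false, h2] using this
  · rintro ⟨h1, h2⟩
    funext i
    simp only [stair]
    split_ifs with hi
    · exact h1 _ (by omega) (by omega)
    · exact h2 _ (by omega) (by omega)

theorem toStairs_eq_iff {y y' : Config S} : toStairs f r M y = toStairs f r M y' ↔
    stair f r M y = stair f r M y' := Subtype.ext_iff

theorem IsSlidingMap.apply_shiftBy (hf : IsSlidingMap f r) (x : Config S) (t i : ℤ) :
    f (shiftBy t x) i = f x (i + t) :=
  hf.shift x t i

theorem stair_congr (hf : IsSlidingMap f r)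
    {y y' : Config S} (h : ∀ p : ℤ, -(r : ℤ) ≤ p → p < M + r → y p = y' p) :
    stair f r M y = stair f r M y' :=
  stair_eq_iff.2 ⟨fun p _ _ => hf.congr _ _ _ fun q _ _ => h q (by omega) (by omega),
    fun p _ _ => h p (by omega) (by omega)⟩

theorem stair_shiftBy_eq_iff (hf : IsSlidingMap f r) {y y' : Config S} :
    stair f r M (shiftBy 1 y) = stair f r M (shiftBy 1 y') ↔
    (∀ p : ℤ, 1 ≤ p → p ≤ M → f y p = f y' p) ∧
      ∀ p : ℤ, (M : ℤ) - r < p → p ≤ M + r → y p = y' p := by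
  rw [stair_eq_iff]
  simp only [hf.apply_shiftBy, shiftBy]
  constructor
  · rintro ⟨h1, h2⟩
    refine ⟨fun p _ _ => ?_, fun p _ _ => ?_⟩
    · simpa using h1 (p - 1) (by omega) (by omega)
    · simpa using h2 (p - 1) (by omega) (by omega)
  · rintro ⟨h1, h2⟩
    exact ⟨fun p _ _ => h1 _ (by omega) (by omega), fun p _ _ => h2 _ (by omega) (by omega)⟩

theorem stairOut_eq_iff (hf : IsSlidingMap f r) {y y' : Config S} :
    stairOut f r M y = stairOut f r M y' ↔
    (∀ p : ℤ, 0 ≤ p → p ≤ M → f y p = f y' p) ∧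
      ∀ p : ℤ, (M : ℤ) - r < p → p ≤ M + r → y p = y' p := by
  rw [stairOut, stairOut, Prod.mk.injEq, toStairs_eq_iff, stair_shiftBy_eq_iff hf, ← and_assoc]
  refine and_congr_left fun _ => ⟨fun h p h0 h1 => ?_, fun h => ⟨h 0 le_rfl (by omega),
    fun p _ _ => h p (by omega) (by omega)⟩⟩
  rcases h0.eq_or_lt with rfl | h0
  · exact h.1
  · exact h.2 p h0 h1

/-- The written cell together with the shifted stair shows exactly the cells of the next longer
stair. -/
theorem stairOut_eq_iff_stair_eq (hf : IsSlidingMap f r) {y y' : Config S} :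
    stairOut f r M y = stairOut f r M y' ↔ stair f r (M + 1) y = stair f r (M + 1) y' := by
  rw [stairOut_eq_iff hf, stair_eq_iff]
  push_cast
  refine and_congr (forall_congr' fun p => imp_congr_right fun _ => ?_)
    (forall_congr' fun p => ?_)
  · rw [Int.lt_add_one_iff]
  · rw [show (M : ℤ) - r < p ↔ (M : ℤ) + 1 - r ≤ p by omega,
      show p ≤ (M : ℤ) + r ↔ p < M + 1 + r by omega]

/-- The cell read completes the window of radius `r` around `M`, which gives the new image cell. So
the transducer is well defined. -/
theorem stairOut_eq_of_stairIn_eq (hf : IsSlidingMap f r) {y y' : Config S}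
    (h : stairIn f r M y = stairIn f r M y') : stairOut f r M y = stairOut f r M y' := by
  rw [stairIn, stairIn, Prod.mk.injEq, toStairs_eq_iff, stair_eq_iff] at h
  obtain ⟨⟨h1, h2⟩, h3⟩ := h
  have h4 : ∀ p : ℤ, (M : ℤ) - r ≤ p → p ≤ M + r → y p = y' p := fun p hp hp' => by
    rcases hp'.eq_or_lt with rfl | hp'
    · exact h3
    · exact h2 p hp hp'
  refine (stairOut_eq_iff hf).2 ⟨fun p h0 hp => ?_, fun p _ hp => h4 p (by omega) hp⟩
  rcases hp.eq_or_lt with rfl | hp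
  · exact hf.congr _ _ _ fun q hq hq' => h4 q hq hq'
  · exact h1 p h0 hp

theorem leftClosing_iff (hf : IsSlidingMap f r) : LeftClosing f r M ↔
    ∀ y y', stairOut f r M y = stairOut f r M y' → stairIn f r M y = stairIn f r M y' := by
  constructor
  · intro h y y' hy
    obtain ⟨h1, h2⟩ := (stairOut_eq_iff hf).1 hy
    have h4 : ∀ p : ℤ, (M : ℤ) - r ≤ p → p ≤ M + r → y p = y' p := fun p hp hp' => by
      rcases hp.eq_or_lt with rfl | hp
      · exact h y y' h1 h2
      · exact h2 p hp hp'
    rw [stairIn, stairIn, Prod.mk.injEq, toStairs_eq_iff, stair_eq_iff]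
    exact ⟨⟨fun p _ _ => h1 p (by omega) (by omega), fun p _ _ => h4 p (by omega) (by omega)⟩,
      h4 _ (by omega) le_rfl⟩
  · intro h y y' h1 h2
    have h3 := h y y' ((stairOut_eq_iff hf).2 ⟨h1, h2⟩)
    rw [stairIn, stairIn, Prod.mk.injEq, toStairs_eq_iff, stair_eq_iff] at h3
    -- For `r = 0` the cell `M - r` is the cell being read, not a cell of the stair.
    rcases Nat.eq_zero_or_pos r with rfl | hr
    · simpa using h3.2
    · exact h3.1.2 _ le_rfl (by omega)

/-- A stair does not depend on cell `M + r`, so any symbol may be read in any state. -/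
theorem stairIn_surjective (hf : IsSlidingMap f r) : Function.Surjective (stairIn f r M) := by
  rintro ⟨⟨_, y, rfl⟩, c⟩
  refine ⟨Function.update y (M + r) c, ?_⟩
  rw [stairIn, Function.update_self, Prod.mk.injEq]
  refine ⟨Subtype.ext (stair_congr hf fun p _ _ => Function.update_of_ne (by omega) _ _), rfl⟩

/-- The left side says that every pair in `S × stairs f r M` is an output. By finiteness this is
injectivity of the transducer, which is left closing. -/
theorem natCard_stairs_succ_eq_iff (hf : IsSlidingMap f r) [Finite S] :
    Nat.card (stairs f r (M + 1)) = Nat.card S * Nat.card (stairs f r M) ↔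
      LeftClosing f r M := by
  have h : Nat.card (stairs f r (M + 1)) = Nat.card (Set.range (stairOut f r M)) :=
    natCard_range_eq fun y y' => (stairOut_eq_iff_stair_eq hf).symm
  rw [h, ← Nat.card_prod, leftClosing_iff hf]
  have hs : Nat.card (Set.range (stairOut f r M)) = Nat.card (S × stairs f r M) ↔
      Function.Surjective (stairOut f r M) := by
    rw [← Set.range_eq_univ, Nat.card_coe_set_eq, ← Set.ncard_univ]
    exact ⟨fun h => Set.eq_of_subset_of_ncard_le (Set.subset_univ _) h.ge, fun h => by rw [h]⟩
  rw [hs]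
  constructor
  · intro hs y y' hy
    exact eq_of_eq_of_surjective (Equiv.prodComm _ _) (stairIn_surjective hf) hs
      (fun _ _ => stairOut_eq_of_stairIn_eq hf) hy
  · intro hy b
    obtain ⟨T, hT⟩ := exists_equiv_of_eq_iff_eq (Equiv.prodComm _ _)
      (stairIn_surjective (M := M) hf)
      fun y y' => ⟨stairOut_eq_of_stairIn_eq hf, hy y y'⟩
    obtain ⟨y, hy⟩ := stairIn_surjective hf (T.symm b)
    exact ⟨y, by rw [← hT, hy, T.apply_symm_apply]⟩

theorem LeftClosing.succ (hf : IsSlidingMap f r)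
    (h : LeftClosing f r M) : LeftClosing f r (M + 1) := by
  intro y y' h1 h2
  have := h (shiftBy 1 y) (shiftBy 1 y') (fun p h0 hp => by
    simp only [hf.apply_shiftBy]
    exact h1 _ (by omega) (by push_cast; omega)) (fun p h0 hp => by
    simp only [shiftBy]
    exact h2 _ (by push_cast; omega) (by push_cast; omega))
  simp only [shiftBy] at this
  push_cast
  rwa [show (M : ℤ) + 1 - r = M - r + 1 by ring]

theorem LeftClosing.mono (hf : IsSlidingMap f r) {M' : ℕ} (hM : M ≤ M') (h : LeftClosing f r M) :
    LeftClosing f r M' := by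
  induction M', hM using Nat.le_induction with
  | base => exact h
  | succ n _ ih => exact ih.succ hf

/-- A repetition in a pair of long words can be pumped. -/
theorem LeftClosing.of_succ (hf : IsSlidingMap f r) [Finite S] (hM : Nat.card S ^ (4 * r) ≤ M)
    (h : LeftClosing f r (M + 1)) : LeftClosing f r M := by
  intro y y' h1 h2
  have := Fintype.ofFinite S
  -- There are `|S| ^ (4 r)` pairs of words of length `2 r` and `M + 1` positions, so a pair of
  -- windows repeats.
  obtain ⟨j, j', hne, hjj⟩ := Fintype.exists_ne_map_eq_of_card_lt
    (fun j : Fin (M + 1) => (fun k : Fin (2 * r) => (y ((j : ℕ) - r + (k : ℕ)),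
      y' ((j : ℕ) - r + (k : ℕ))))) (by
    rw [Nat.card_eq_fintype_card] at hM
    simp only [Fintype.card_fun, Fintype.card_prod, Fintype.card_fin, ← sq, ← pow_mul]
    rw [← mul_assoc]
    exact Nat.lt_succ_of_le hM)
  wlog hlt : j < j' generalizing j j'
  · exact this j' j hne.symm hjj.symm (lt_of_le_of_ne (not_lt.1 hlt) hne.symm)
  have hrep : ∀ p : ℤ, (j : ℕ) - (r : ℤ) ≤ p → p < (j : ℕ) + r →
      y p = y (p + ((j' : ℕ) - (j : ℕ))) ∧ y' p = y' (p + ((j' : ℕ) - (j : ℕ))) := by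
    intro p hp hp'
    have := congrFun hjj ⟨(p - ((j : ℕ) - r)).toNat, by omega⟩
    have e1 : ((j : ℕ) : ℤ) - r + ((p - ((j : ℕ) - r)).toNat : ℤ) = p := by omega
    have e2 : ((j' : ℕ) : ℤ) - r + ((p - ((j : ℕ) - r)).toNat : ℤ) =
      p + ((j' : ℕ) - (j : ℕ)) := by omega
    simp only [e1, e2, Prod.mk.injEq] at this
    exact this
  -- Repeats the segment between the two equal windows. Every window of radius `r` in the result
  -- already occurs in `x`, so the images agree on at least one further cell to the left.
  let pump : Config S → Config S := fun x p =>
    if (j : ℕ) - (r : ℤ) ≤ p then x p else x (p + ((j' : ℕ) - (j : ℕ)))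
  have hge : ∀ (x : Config S) (i : ℤ), (j : ℕ) ≤ i → f (pump x) i = f x i := fun x i hi =>
    hf.congr _ _ _ fun q _ _ => if_pos (by omega)
  have hlt' : ∀ x : Config S, (∀ p : ℤ, (j : ℕ) - (r : ℤ) ≤ p → p < (j : ℕ) + r →
      x p = x (p + ((j' : ℕ) - (j : ℕ)))) → ∀ i : ℤ, i < (j : ℕ) →
      f (pump x) i = f x (i + ((j' : ℕ) - (j : ℕ))) := by
    intro x hx i hi
    rw [← hf.shift]
    refine hf.congr _ _ _ fun q _ _ => ?_
    simp only [pump]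
    split_ifs with hq
    · exact hx q hq (by omega)
    · rfl
  have hj' := j'.isLt
  have hd : (j : ℕ) < (j' : ℕ) := hlt
  -- The pumped images agree on `[-1, M]`; the shift moves this to `[0, M + 1]`.
  have key := h (shiftBy (-1) (pump y)) (shiftBy (-1) (pump y')) (fun p h0 hp => by
    push_cast at hp
    simp only [hf.apply_shiftBy]
    rcases lt_or_ge (p + -1) ((j : ℕ) : ℤ) with hpj | hpj
    · rw [hlt' y (fun p a b => (hrep p a b).1) _ hpj, hlt' y' (fun p a b => (hrep p a b).2) _ hpj]
      exact h1 _ (by omega) (by omega)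
    · rw [hge _ _ hpj, hge _ _ hpj]
      exact h1 _ (by omega) (by omega)) (fun p h0 hp => by
    push_cast at h0 hp
    simp only [shiftBy, pump]
    rw [if_pos (by omega), if_pos (by omega)]
    exact h2 _ (by omega) (by omega))
  simp only [shiftBy, pump] at key
  push_cast at key
  rw [show (M : ℤ) + 1 - r + -1 = M - r by ring, if_pos (by omega), if_pos (by omega)] at key
  exact key

theorem LeftClosing.of_le (hf : IsSlidingMap f r)
    [Finite S] {M' : ℕ} (hM : Nat.card S ^ (4 * r) ≤ M) (hM' : M ≤ M')
    (h : LeftClosing f r M') : LeftClosing f r M := by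
  induction M', hM' using Nat.le_induction with
  | base => exact h
  | succ n hn ih => exact ih (h.of_succ hf (hM.trans hn))

theorem LeftClosing.natCard_stairs_add (hf : IsSlidingMap f r)
    [Finite S] (h : LeftClosing f r M) (t : ℕ) :
    Nat.card (stairs f r (M + t)) = Nat.card S ^ t * Nat.card (stairs f r M) := by
  induction t with
  | zero => simp
  | succ t ih =>
    rw [← add_assoc, (natCard_stairs_succ_eq_iff hf).2 (h.mono hf (by omega)), ih]
    ring

end Stairs

/-! ### From a bijective transducer to a block rule. -/

section LeftClosingToSlider

variable {S : Type*} {f : Config S → Config S} {r M : ℕ}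

/-- A bijective transducer on the words of length `n` as a bijective block rule: the last cell of
the block is read, and the first one is written. -/
def transducerRule {n : ℕ} (U : S × (Fin n → S) ≃ S × (Fin n → S)) :
    Equiv.Perm (Fin (n + 1) → S) :=
  ((Fin.snocEquiv fun _ => S).symm.trans U).trans (Fin.consEquiv fun _ => S)

theorem IsRun.transducerRule {n : ℕ} {U : S × (Fin n → S) ≃ S × (Fin n → S)}
    {X : ℤ → Config S} (hX : IsRun (transducerRule U) X) (j : ℤ) :
    U (X j (j + n), fun k : Fin n => X j (j + (k : ℕ))) =
      (X (j + 1) j, fun k : Fin n => X (j + 1) (j + 1 + (k : ℕ))) := by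
  have h : ∀ k : Fin (n + 1), X (j + 1) (j + (k : ℕ)) =
      Fin.consEquiv (fun _ => S) (U (X j (j + n), fun k : Fin n => X j (j + (k : ℕ)))) k := by
    intro k
    rw [hX j, applyAt_block]
    simp [_root_.transducerRule, Fin.snocEquiv, Fin.init_def]
  refine Prod.ext ?_ (funext fun k => ?_)
  · have := h 0
    simp [Fin.consEquiv] at this
    exact this.symm
  · have := h k.succ
    simp [Fin.consEquiv] at this
    rw [← this]
    congr 1
    ring

theorem IsSlider.of_leftClosing [Finite S] [Nonempty S] (hf : IsSlidingMap f r)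
    (h : LeftClosing f r M) (hd : Nat.card (stairs f r M) ∣ Nat.card S ^ (M + r)) :
    IsSlider f := by
  obtain ⟨N, hN⟩ := hd
  obtain ⟨T, hT⟩ := exists_equiv_of_eq_iff_eq (Equiv.prodComm _ _)
    (stairIn_surjective (M := M) hf)
    fun y y' => ⟨stairOut_eq_of_stairIn_eq hf, (leftClosing_iff hf).1 h y y'⟩
  obtain ⟨e⟩ : Nonempty ((Fin (M + r) → S) ≃ stairs f r M × Fin N) := by
    rw [← Finite.card_eq, Nat.card_prod, Nat.card_fun]
    simpa using hN
  -- The transducer acts on the stair component of a word; the label in `Fin N` is carried along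
  -- unchanged.
  let U : S × (Fin (M + r) → S) ≃ S × (Fin (M + r) → S) :=
    { toFun := fun w => ((T ((e w.2).1, w.1)).1, e.symm ((T ((e w.2).1, w.1)).2, (e w.2).2))
      invFun := fun w => ((T.symm (w.1, (e w.2).1)).2,
        e.symm ((T.symm (w.1, (e w.2).1)).1, (e w.2).2))
      left_inv := fun w => by simp
      right_inv := fun w => by simp }
  have key : ∀ X, IsRun (transducerRule U) X → ∀ p,
      X (p + 1) p = f (fun q => X (q - (M + r + 1 : ℕ)) q) p := by
    intro X hX p
    let Q : ℤ → Fin (M + r) → S := fun j k => X j (j + (k : ℕ))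
    have hread : ∀ j, X j (j + (M + r : ℕ)) =
        X (j + (M + r : ℕ) - (M + r + 1 : ℕ)) (j + (M + r : ℕ)) := by
      intro j
      rw [← hX.eq_of_add_le (j := j - 1) (by push_cast; omega)]
      conv_lhs => rw [← sub_add_cancel j 1, hX]
      rw [sub_add_cancel, applyAt_of_notMem _ _ (by push_cast; omega)]
    have hstep : ∀ j, T ((e (Q j)).1, X j (j + (M + r : ℕ))) =
        (X (j + 1) j, (e (Q (j + 1))).1) := by
      intro j
      have h1 := hX.transducerRule j
      rw [Prod.ext_iff] at h1
      have h2 : e.symm ((T ((e (Q j)).1, X j (j + (M + r : ℕ)))).2, (e (Q j)).2) = Q (j + 1) :=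
        h1.2
      exact Prod.ext h1.1 (by rw [← h2, e.apply_symm_apply])
    -- At time `j₀` the cell read is `j₀ + M + r = p - r`, the first of the window of `p`.
    let j₀ : ℤ := p - M - 2 * r
    obtain ⟨y₀, hy₀⟩ := (e (Q j₀)).1.2
    -- The state at time `j₀` is a stair of some `y₀`. Gluing `y₀` to the cells read from then on
    -- gives one configuration whose stairs are all later states.
    let y : Config S := fun q => if q < j₀ + M + r then y₀ (q - j₀)
      else X (q - (M + r + 1 : ℕ)) q
    have hrun : ∀ l : ℕ, (e (Q (j₀ + l))).1 = toStairs f r M (shiftBy (j₀ + l) y) := by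
      intro l
      induction l with
      | zero =>
        simp only [Nat.cast_zero, add_zero]
        refine Subtype.ext (hy₀.symm.trans (stair_congr hf fun q hq hq' => ?_))
        simp only [shiftBy, y]
        rw [if_pos (by omega), add_sub_cancel_right]
      | succ l ih =>
        have h1 := hstep (j₀ + l)
        have h2 : X (j₀ + l) (j₀ + l + (M + r : ℕ)) = shiftBy (j₀ + l) y (M + r) := by
          rw [hread]
          simp only [shiftBy, y]
          rw [if_neg (by omega)]
          congr 1 <;> omega
        rw [ih, h2, ← stairIn, hT, stairOut, Prod.mk.injEq] at h1
        rw [Nat.cast_succ, ← add_assoc, ← h1.2]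
        congr 1
        funext q
        simp only [shiftBy]
        congr 1
        ring
    have hp : p = j₀ + (M + 2 * r : ℕ) := by simp only [j₀]; push_cast; ring
    have h1 := hstep p
    have h2 : X p (p + (M + r : ℕ)) = shiftBy p y (M + r) := by
      rw [hread]
      simp only [shiftBy, y]
      rw [if_neg (by omega)]
      congr 1 <;> omega
    have h3 := hrun (M + 2 * r)
    rw [← hp] at h3
    rw [h3, h2, ← stairIn, hT, stairOut, Prod.mk.injEq, hf.apply_shiftBy, zero_add] at h1
    rw [← h1.1]
    exact hf.congr _ _ _ fun q hq _ => if_neg (by omega)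
  refine ⟨_, transducerRule U, fun y z => ?_⟩
  rw [sliderRel_iff]
  constructor
  · rintro ⟨X, hX, hy, hz⟩
    funext p
    rw [← hz, key X hX]
    exact congrFun (congrArg f (funext fun q => (hy q).symm)) p
  · rintro rfl
    let : TopologicalSpace S := ⊥
    have : DiscreteTopology S := ⟨rfl⟩
    obtain ⟨x, rfl⟩ := surjective_toLeft (transducerRule U) 0 y
    obtain ⟨X, hX, rfl⟩ := exists_isRun (transducerRule U) 0 x
    rw [hX.toLeft_eq]
    exact ⟨X, hX, fun _ => rfl, key X hX⟩

end LeftClosingToSlider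

/-! ### From a slider to left closing and divisibility. -/

section SliderToLeftClosing

variable {S : Type*} {m : ℕ}

/-- While all blocks applied lie inside `[i, b)`, these cells evolve independently of the others. -/
theorem IsRun.congr_right {χ : (Fin m → S) → (Fin m → S)} {X X' : ℤ → Config S} (hX : IsRun χ X)
    (hX' : IsRun χ X') {i b : ℤ} (h : ∀ p, i ≤ p → p < b → X i p = X' i p) (j : ℤ) (hj : i ≤ j)
    (hb : j + m ≤ b + 1) (p : ℤ) (hp : i ≤ p) (hp' : p < b) : X j p = X' j p := by
  induction j, hj using Int.leInduction generalizing p with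
  | base => exact h p hp hp'
  | succ j hj ih =>
    rw [hX, hX']
    exact applyAt_congr χ (fun p => i ≤ p ∧ p < b) (fun q hq hq' => ⟨by omega, by omega⟩)
      (fun q hq => ih (by omega) q hq.1 hq.2) p ⟨hp, hp'⟩

variable {f : Config S → Config S} {r M : ℕ} {χ : Equiv.Perm (Fin m → S)}

/-- One step of a run keeps its first diagonal; only the origin moves. -/
theorem toLeft_shiftBy_applyAt (x : Config S) :
    toLeft χ.symm 0 (shiftBy 1 (applyAt χ 0 x)) = shiftBy 1 (toLeft χ.symm 0 x) := by
  obtain ⟨X, hX, rfl⟩ := exists_isRun χ 0 x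
  have h1 : shiftBy 1 (applyAt χ 0 (X 0)) = (fun j p => X (j + 1) (p + 1)) 0 := by
    rw [← hX]; rfl
  rw [h1, (hX.shift 1).toLeft_eq, hX.toLeft_eq]
  funext p
  simp only [shiftBy]
  congr 1
  ring

theorem toRight_zero (x : Config S) : toRight χ 0 x 0 = applyAt χ 0 x 0 := by
  obtain ⟨X, hX, rfl⟩ := exists_isRun χ 0 x
  rw [hX.toRight_eq, ← hX]

theorem toLeft_of_le (x : Config S) {p : ℤ} (hp : m ≤ p) : toLeft χ.symm 0 x p = x p := by
  obtain ⟨X, hX, rfl⟩ := exists_isRun χ 0 x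
  rw [hX.toLeft_eq, hX.eq_of_add_le (by omega)]

/-- Image cells far enough from the right end are produced by blocks inside `[0, M + r)`. The
others, and the input part of the stair, depend only on cells from `m` on, which the left sweep
leaves alone; `2 * m + r ≤ M` makes the two ranges overlap. -/
theorem stair_toLeft_congr (hf : IsSlidingMap f r)
    (h : ∀ x, f (toLeft χ.symm 0 x) = toRight χ 0 x) (hM : 2 * m + r ≤ M) {x x' : Config S}
    (hx : ∀ p : ℤ, 0 ≤ p → p < M + r → x p = x' p) :
    toStairs f r M (toLeft χ.symm 0 x) = toStairs f r M (toLeft χ.symm 0 x') := by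
  have h1 : ∀ p : ℤ, m ≤ p → p < M + r → toLeft χ.symm 0 x p = toLeft χ.symm 0 x' p :=
    fun p hp hp' => by rw [toLeft_of_le x hp, toLeft_of_le x' hp, hx p (by omega) hp']
  refine toStairs_eq_iff.2 (stair_eq_iff.2 ⟨fun p h0 hp => ?_, fun p hp hp' =>
    h1 p (by omega) hp'⟩)
  by_cases hpm : p + m ≤ M + r
  · rw [h, h]
    obtain ⟨X, hX, rfl⟩ := exists_isRun χ 0 x
    obtain ⟨X', hX', rfl⟩ := exists_isRun χ 0 x'
    rw [hX.toRight_eq, hX'.toRight_eq]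
    exact hX.congr_right hX' hx _ (by omega) (by omega) p h0 (by omega)
  · exact hf.congr _ _ _ fun q _ _ => h1 q (by omega) (by omega)

/-- The word of length `W` at position `0`, followed by the next cell. -/
def wordIn (W : ℕ) (x : Config S) : (Fin W → S) × S := (fun k => x (k : ℕ), x W)

/-- The cell `0`, followed by the word of length `W` at position `1`. -/
def wordOut (W : ℕ) (x : Config S) : S × (Fin W → S) := (x 0, fun k => x ((k : ℕ) + 1))

theorem word_eq_iff {W : ℕ} {x x' : Config S} :
    ((fun k : Fin W => x (k : ℕ)) = fun k : Fin W => x' (k : ℕ)) ↔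
      ∀ p : ℤ, 0 ≤ p → p < W → x p = x' p := by
  constructor
  · intro h p h0 hp
    have := congrFun h ⟨p.toNat, by omega⟩
    simpa [h0] using this
  · intro h
    funext k
    exact h _ (by omega) (by omega)

theorem wordIn_eq_iff {W : ℕ} {x x' : Config S} :
    wordIn W x = wordIn W x' ↔ ∀ p : ℤ, 0 ≤ p → p ≤ W → x p = x' p := by
  rw [wordIn, wordIn, Prod.mk.injEq, word_eq_iff]
  constructor
  · rintro ⟨h1, h2⟩ p h0 hp
    rcases hp.eq_or_lt with rfl | hp
    · exact h2
    · exact h1 p h0 hp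
  · exact fun h => ⟨fun p h0 hp => h p h0 hp.le, h _ (by omega) le_rfl⟩

theorem wordOut_eq_iff {W : ℕ} {x x' : Config S} :
    wordOut W x = wordOut W x' ↔ ∀ p : ℤ, 0 ≤ p → p ≤ W → x p = x' p := by
  have h := word_eq_iff (W := W) (x := shiftBy 1 x) (x' := shiftBy 1 x')
  simp only [shiftBy] at h
  rw [wordOut, wordOut, Prod.mk.injEq, h]
  constructor
  · rintro ⟨h1, h2⟩ p h0 hp
    rcases h0.eq_or_lt with rfl | h0
    · exact h1
    · simpa using h2 (p - 1) (by omega) (by omega)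
  · exact fun h => ⟨h 0 le_rfl (by omega), fun p _ _ => h _ (by omega) (by omega)⟩

theorem wordIn_surjective (W : ℕ) : Function.Surjective (wordIn W : Config S → _) := by
  rintro ⟨q, c⟩
  refine ⟨fun p => if h : 0 ≤ p ∧ p < W then q ⟨p.toNat, by omega⟩ else c, ?_⟩
  simp [wordIn]

/-- The block fits into the first `W` cells, so `χ` acts bijectively on words of length `W + 1`. -/
theorem exists_wordEquiv [Finite S] (χ : Equiv.Perm (Fin m → S)) {W : ℕ} (hW : m ≤ W) :
    ∃ U : (Fin W → S) × S ≃ S × (Fin W → S), ∀ x, U (wordIn W x) = wordOut W (applyAt χ 0 x) := by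
  refine exists_equiv_of_eq_iff_eq (Equiv.prodComm _ _) (wordIn_surjective W) fun x x' => ?_
  rw [wordIn_eq_iff, wordOut_eq_iff]
  have hA : ∀ p : ℤ, 0 ≤ p → p < 0 + (m : ℤ) → 0 ≤ p ∧ p ≤ W := fun p _ _ => by omega
  constructor
  · intro h p h0 hp
    exact applyAt_congr χ (fun p => 0 ≤ p ∧ p ≤ W) hA (fun q hq => h q hq.1 hq.2) p ⟨h0, hp⟩
  · intro h p h0 hp
    rw [← applyAt_symm_apply χ 0 x, ← applyAt_symm_apply χ 0 x']
    exact applyAt_congr χ.symm (fun p => 0 ≤ p ∧ p ≤ W) hA (fun q hq => h q hq.1 hq.2) p ⟨h0, hp⟩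

theorem stairOut_surjective [Finite S] (hf : IsSlidingMap f r)
    (h : ∀ x, f (toLeft χ.symm 0 x) = toRight χ 0 x) (hM : 2 * m + r ≤ M) :
    Function.Surjective (stairOut f r M) := by
  rintro ⟨a, _, y, rfl⟩
  let : TopologicalSpace S := ⊥
  have : DiscreteTopology S := ⟨rfl⟩
  obtain ⟨x, rfl⟩ := surjective_toLeft χ 0 y
  -- A predecessor is built by prescribing the written symbol `a` at cell 0, placing `x` after it,
  -- and undoing `χ` there.
  let x' : Config S := Function.update (shiftBy (-1) x) 0 a
  refine ⟨toLeft χ.symm 0 (applyAt χ.symm 0 x'), Prod.ext ?_ ?_⟩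
  · simp only [stairOut]
    rw [h, toRight_zero, applyAt_apply_symm]
    exact Function.update_self _ _ _
  · simp only [stairOut]
    rw [← toLeft_shiftBy_applyAt, applyAt_apply_symm]
    refine stair_toLeft_congr hf h hM fun p h0 _ => ?_
    simp only [shiftBy, x']
    rw [Function.update_of_ne (by omega)]
    simp [shiftBy]

theorem leftClosing_of_slider [Finite S] (hf : IsSlidingMap f r)
    (h : ∀ x, f (toLeft χ.symm 0 x) = toRight χ 0 x) (hM : 2 * m + r ≤ M) :
    LeftClosing f r M :=
  (leftClosing_iff hf).2 fun _ _ => eq_of_eq_of_surjective (Equiv.prodComm _ _)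
    (stairIn_surjective hf) (stairOut_surjective hf h hM)
    fun _ _ => stairOut_eq_of_stairIn_eq hf

/-- The map `π` from words to stairs intertwines two bijective transducers, so its fibre sizes are
constant along transitions. Any stair leads to any other, hence all fibres have the same size and
the number of words is a multiple of the number of stairs. -/
theorem natCard_stairs_dvd_of_slider [Finite S] [Nonempty S] (hf : IsSlidingMap f r)
    (h : ∀ x, f (toLeft χ.symm 0 x) = toRight χ 0 x) (hM : 2 * m + r ≤ M) :
    Nat.card (stairs f r M) ∣ Nat.card S ^ (M + r) := by
  obtain ⟨T, hT⟩ := exists_equiv_of_eq_iff_eq (Equiv.prodComm _ _)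
    (stairIn_surjective (M := M) hf)
    fun y y' => ⟨stairOut_eq_of_stairIn_eq hf,
      (leftClosing_iff hf).1 (leftClosing_of_slider hf h hM) y y'⟩
  obtain ⟨U, hU⟩ := exists_wordEquiv χ (W := M + r) (by omega)
  obtain ⟨π, hπ⟩ := ((Prod.fst_surjective (β := S)).comp
    (wordIn_surjective (S := S) (M + r))).exists_factor
    (β := fun x => toStairs f r M (toLeft χ.symm 0 x)) fun x x' hx =>
      stair_toLeft_congr hf h hM (by simpa using word_eq_iff.1 hx)
  have hcomm : ∀ q c, T (π q, c) = ((U (q, c)).1, π (U (q, c)).2) := by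
    intro q c
    obtain ⟨x, hx⟩ := wordIn_surjective (M + r) (q, c)
    rw [← hx, hU]
    have h1 : π q = toStairs f r M (toLeft χ.symm 0 x) := by
      rw [← hπ]; simp [hx]
    have h2 : c = toLeft χ.symm 0 x (M + r) := by
      rw [toLeft_of_le x (by omega)]
      simpa [wordIn] using (congrArg Prod.snd hx).symm
    rw [h1, h2, ← stairIn, hT, stairOut, h, toRight_zero, ← toLeft_shiftBy_applyAt, ← hπ]
    rfl
  let n : Config S → ℕ := fun y => Nat.card {q // π q = toStairs f r M y}
  have hn : ∀ y, n y = n (shiftBy 1 y) := fun y =>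
    natCard_fiber_eq U T π hcomm (c := y (M + r)) (a := f y 0) (hT y)
  have hn' : ∀ (t : ℕ) y, n y = n (shiftBy t y) := by
    intro t
    induction t with
    | zero => intro y; congr 1; funext p; simp [shiftBy]
    | succ t ih =>
      intro y
      rw [ih, hn]
      congr 1
      funext p
      simp only [shiftBy]
      congr 1
      push_cast
      ring
  have hcongr : ∀ y y', (∀ p : ℤ, -(r : ℤ) ≤ p → p < M + r → y p = y' p) → n y = n y' := by
    intro y y' hy
    simp only [n, toStairs_eq_iff.2 (stair_congr hf hy)]
  have hconst : ∀ y y', n y = n y' := by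
    intro y y'
    -- A stair depends only on cells in `[-r, M + r)`, so an offset of `M + 2 r` puts the data of
    -- both stairs side by side in one configuration.
    let w : Config S := fun p => if p < M + r then y p else y' (p - (M + 2 * r : ℕ))
    rw [hcongr y w fun p _ hp => (if_pos hp).symm, hn' (M + 2 * r) w]
    refine hcongr _ _ fun p hp _ => ?_
    simp only [shiftBy, w]
    rw [if_neg (by push_cast; omega), add_sub_cancel_right]
  have := Fintype.ofFinite (stairs f r M)
  obtain ⟨a⟩ := ‹Nonempty S›
  refine ⟨n fun _ => a, ?_⟩
  have hQ : Nat.card (Fin (M + r) → S) = Nat.card S ^ (M + r) := by simp [Nat.card_fun]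
  rw [← hQ, ← Nat.card_congr (Equiv.sigmaFiberEquiv π), Nat.card_sigma,
    Finset.sum_congr rfl (g := fun _ => n fun _ => a) fun p _ => ?_]
  · simp
  · obtain ⟨_, y, rfl⟩ := p
    exact hconst y _

end SliderToLeftClosing

/-! ### The counting criterion. -/

theorem isSlider_iff {S : Type*} [Finite S] [Nonempty S] {f : Config S → Config S} {r B : ℕ}
    (hf : IsSlidingMap f r) (hB : B = Nat.card S ^ (4 * r)) :
    IsSlider f ↔ Nat.card (stairs f r (B + 1)) = Nat.card S * Nat.card (stairs f r B) ∧
      Nat.card (stairs f r B) ∣ Nat.card S ^ (B + r) := by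
  rw [natCard_stairs_succ_eq_iff hf]
  constructor
  · rintro ⟨m, χ, h⟩
    have h' : ∀ x, f (toLeft χ.symm 0 x) = toRight χ 0 x := fun x =>
      (h _ _).1 ⟨x, 0, rfl, rfl⟩
    have hc : LeftClosing f r B := (leftClosing_of_slider hf h'
      (M := B + (2 * m + r)) (by omega)).of_le hf hB.ge (by omega)
    refine ⟨hc, ?_⟩
    have hd := natCard_stairs_dvd_of_slider hf h' (M := B + (2 * m + r)) (by omega)
    -- Lengthening the stairs by `2 m + r` multiplies both sides of the divisibility by the same
    -- power of `|S|`, which cancels.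
    rw [hc.natCard_stairs_add hf, show B + (2 * m + r) + r = (2 * m + r) + (B + r) by ring,
      pow_add _ (2 * m + r) (B + r)] at hd
    exact Nat.dvd_of_mul_dvd_mul_left (pow_pos Nat.card_pos _) hd
  · exact fun h => IsSlider.of_leftClosing hf h.1 h.2

/-! ### Words as numbers in base `s`, and counting stairs from a code. -/

section Digits

variable {s : ℕ}

theorem finFunctionFinEquiv_div_mod {n : ℕ} (w : Fin n → Fin s) (i : Fin n) :
    (finFunctionFinEquiv w : ℕ) / s ^ (i : ℕ) % s = w i := by
  conv_rhs => rw [← finFunctionFinEquiv.symm_apply_apply w]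
  rfl

theorem finFunctionFinEquiv_window {k : ℕ} (hs : 0 < s) (a i : ℕ) (w : Fin k → Fin s)
    (hw : ∀ j : Fin k, (w j : ℕ) = a / s ^ (i + j) % s) :
    (finFunctionFinEquiv w : ℕ) = a / s ^ i % s ^ k := by
  have hlt : a / s ^ i % s ^ k < s ^ k := Nat.mod_lt _ (pow_pos hs k)
  have h : w = finFunctionFinEquiv.symm ⟨a / s ^ i % s ^ k, hlt⟩ := by
    funext j
    apply Fin.ext
    rw [hw]
    change _ = a / s ^ i % s ^ k / s ^ (j : ℕ) % s
    obtain ⟨d, hd⟩ := Nat.exists_eq_add_of_lt j.isLt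
    have hk : s ^ k = s ^ (j : ℕ) * s ^ (d + 1) := by rw [← pow_add]; congr 1
    rw [hk, Nat.mod_mul_right_div_self, Nat.div_div_eq_div_mul, ← pow_add,
      Nat.mod_mod_of_dvd _ (dvd_pow_self s (Nat.succ_ne_zero d))]
  rw [h, Equiv.apply_symm_apply]

theorem div_pow_eq_of_digits {a b M k : ℕ} (hs : 0 < s) (ha : a < s ^ (M + k))
    (hb : b < s ^ (M + k)) (h : ∀ j < k, a / s ^ (M + j) % s = b / s ^ (M + j) % s) :
    a / s ^ M = b / s ^ M := by
  have hw := fun c => finFunctionFinEquiv_window (k := k) hs c M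
    (fun j => ⟨c / s ^ (M + j) % s, Nat.mod_lt _ hs⟩) fun _ => rfl
  have hlt : ∀ c, c < s ^ (M + k) → c / s ^ M < s ^ k := fun c hc =>
    Nat.div_lt_of_lt_mul (by rwa [← pow_add])
  rw [← Nat.mod_eq_of_lt (hlt a ha), ← Nat.mod_eq_of_lt (hlt b hb), ← hw a, ← hw b]
  congr 2
  funext j
  exact Fin.ext (h j j.isLt)

end Digits

/-- The number `p` codes a stair, with `M` cells of the image, of the cellular automaton with
code `c`. -/
def CACode.StairCode (c : CACode) (M p : ℕ) : Prop :=
  ∃ u < c.1 ^ (M + 2 * c.2.1), u / c.1 ^ M = p / c.1 ^ M ∧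
    ∀ i < M, c.2.2[u / c.1 ^ i % c.1 ^ (2 * c.2.1 + 1)]? = some (p / c.1 ^ i % c.1)

instance (c : CACode) (M : ℕ) : DecidablePred (c.StairCode M) := fun p => by
  unfold CACode.StairCode; infer_instance

/-- The number of stairs. -/
def CACode.stairCount (c : CACode) (M : ℕ) : ℕ :=
  ((List.range (c.1 ^ (M + 2 * c.2.1))).filter fun p => c.StairCode M p).length

/-- The condition that characterizes sliders, in terms of the code. -/
def CACode.SliderCondition (c : CACode) : Prop :=
  c.1 = 0 ∨
    c.stairCount (c.1 ^ (4 * c.2.1) + 1) = c.1 * c.stairCount (c.1 ^ (4 * c.2.1)) ∧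
    c.stairCount (c.1 ^ (4 * c.2.1)) ∣ c.1 ^ (c.1 ^ (4 * c.2.1) + c.2.1)

instance : DecidablePred CACode.SliderCondition := fun c => by
  unfold CACode.SliderCondition; infer_instance

section Presents

variable {S : Type*} {f : Config S → Config S} {c : CACode}

theorem CACode.Presents.isSlidingMap (h : c.Presents f) : IsSlidingMap f c.2.1 := by
  obtain ⟨e, h⟩ := h
  refine ⟨fun x y i hxy => ?_, fun x t i => ?_⟩
  all_goals
    apply e.injective
    apply Fin.val_injective
    apply Option.some_injective
    rw [← h, ← h]
    congr 3
    funext j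
  · rw [hxy _ (by omega) (by omega)]
  · congr 2
    ring

theorem CACode.Presents.natCard (h : c.Presents f) : Nat.card S = c.1 := by
  obtain ⟨e, -⟩ := h
  simp [Nat.card_congr e]

/-- The witness `u` in `StairCode` codes the cells `-r, …, M + r - 1` of a preimage: its `2 r + 1`
digits from index `i` on are the window of cell `i`, and its top `2 r` digits are the input part of
the stair. -/
theorem stairCode_iff [Nonempty S] {e : S ≃ Fin c.1} (h : ∀ (x : Config S) (i : ℤ),
    c.2.2[((finFunctionFinEquiv (fun j : Fin (2 * c.2.1 + 1) =>
      e (x (i - (c.2.1 : ℤ) + ((j : ℕ) : ℤ)))) : Fin (c.1 ^ (2 * c.2.1 + 1))) : ℕ)]?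
      = some ((e (f x i) : Fin c.1) : ℕ)) {M : ℕ} (w : Fin (M + 2 * c.2.1) → S) :
    c.StairCode M (finFunctionFinEquiv fun i => e (w i)) ↔ w ∈ stairs f c.2.1 M := by
  obtain ⟨s, r, T⟩ := c
  simp only [CACode.StairCode] at *
  obtain ⟨a₀⟩ := ‹Nonempty S›
  have hs : 0 < s := (Nat.zero_le _).trans_lt (e a₀).isLt
  have hw : ∀ (i : ℕ) (hi : i < M + 2 * r), (finFunctionFinEquiv fun i => e (w i) : ℕ) / s ^ i % s
      = e (w ⟨i, hi⟩) := fun i hi => finFunctionFinEquiv_div_mod (fun i => e (w i)) ⟨i, hi⟩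
  have htab : ∀ (u : ℕ) (y : Config S), (∀ i < M + 2 * r, u / s ^ i % s = e (y (i - r))) →
      ∀ i < M, T[u / s ^ i % s ^ (2 * r + 1)]? = some ((e (f y i) : Fin s) : ℕ) := by
    intro u y hu i hi
    rw [← h, finFunctionFinEquiv_window hs u i]
    intro j
    rw [hu _ (by omega)]
    congr 3
    push_cast
    ring
  constructor
  · rintro ⟨u, hu, hdiv, hT⟩
    let y : Config S := fun p => e.symm ⟨u / s ^ (p + r).toNat % s, Nat.mod_lt _ hs⟩
    have hy : ∀ i < M + 2 * r, u / s ^ i % s = e (y (i - r)) := by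
      intro i _
      simp [y]
    refine ⟨y, funext fun i => ?_⟩
    simp only [stair]
    apply e.injective
    apply Fin.val_injective
    split_ifs with hi
    · rw [← hw i i.isLt]
      exact Option.some_injective _ ((htab u y hy i hi).symm.trans (hT i hi))
    · rw [← hw i i.isLt, ← hy i i.isLt]
      obtain ⟨d, hd⟩ := Nat.exists_eq_add_of_le (not_lt.1 hi)
      rw [hd, pow_add, ← Nat.div_div_eq_div_mul, hdiv, Nat.div_div_eq_div_mul]
  · rintro ⟨y, rfl⟩
    let v : Fin (M + 2 * r) → Fin s := fun i => e (y ((i : ℕ) - r))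
    have hv : ∀ i < M + 2 * r, (finFunctionFinEquiv v : ℕ) / s ^ i % s = e (y (i - r)) :=
      fun i hi => finFunctionFinEquiv_div_mod v ⟨i, hi⟩
    refine ⟨finFunctionFinEquiv v, (finFunctionFinEquiv v).isLt, ?_, fun i hi => ?_⟩
    · refine div_pow_eq_of_digits hs (finFunctionFinEquiv v).isLt (Fin.isLt _) fun j hj => ?_
      rw [hv _ (by omega), hw _ (by omega)]
      simp [stair]
    · rw [htab _ y hv i hi, hw i (by omega)]
      simp [stair, hi]

theorem CACode.Presents.stairCount_eq [Nonempty S] (h : c.Presents f) (M : ℕ) :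
    c.stairCount M = Nat.card (stairs f c.2.1 M) := by
  obtain ⟨e, h⟩ := h
  let E : (Fin (M + 2 * c.2.1) → S) ≃ Fin (c.1 ^ (M + 2 * c.2.1)) :=
    (Equiv.arrowCongr (Equiv.refl _) e).trans finFunctionFinEquiv
  have h1 : Nat.card (stairs f c.2.1 M) =
      Nat.card {p : Fin (c.1 ^ (M + 2 * c.2.1)) // c.StairCode M p} :=
    Nat.card_congr (E.subtypeEquiv fun w => (stairCode_iff h w).symm)
  have h2 : c.stairCount M =
      ((Finset.range (c.1 ^ (M + 2 * c.2.1))).filter fun p => c.StairCode M p).card := rfl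
  rw [h1, h2, ← Nat.card_eq_finsetCard]
  exact Eq.symm <| Nat.card_congr
    { toFun := fun p => ⟨p.1, Finset.mem_filter.2 ⟨Finset.mem_range.2 p.1.2, p.2⟩⟩
      invFun := fun p => ⟨⟨p.1, Finset.mem_range.1 (Finset.mem_filter.1 p.2).1⟩,
        (Finset.mem_filter.1 p.2).2⟩
      left_inv := fun _ => rfl
      right_inv := fun _ => rfl }

theorem CACode.Presents.sliderCondition_iff (h : c.Presents f) :
    c.SliderCondition ↔ IsSlider f := by
  have hf := h.isSlidingMap
  have hc := h.natCard
  have : Finite S := by obtain ⟨e, -⟩ := h; exact Finite.of_equiv _ e.symm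
  rcases isEmpty_or_nonempty S with hS | hS
  -- Over the empty alphabet there are no configurations, so every map is a slider.
  · refine ⟨fun _ => ⟨0, Equiv.refl _, fun y => (hS.false (y 0)).elim⟩, fun _ => Or.inl ?_⟩
    rw [← hc, Nat.card_of_isEmpty]
  · rw [isSlider_iff hf rfl, hc, ← h.stairCount_eq, ← h.stairCount_eq]
    refine or_iff_right ?_
    rw [← hc]
    exact Nat.card_pos.ne'

end Presents

/-! ### Primitive recursiveness of the criterion. -/

section Computability

open Primrec

theorem primrec_pow : Primrec₂ ((· ^ ·) : ℕ → ℕ → ℕ) := Primrec₂.unpaired'.1 Nat.Primrec.pow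

theorem primrecRel_dvd : PrimrecRel ((· ∣ ·) : ℕ → ℕ → Prop) :=
  PrimrecPred.of_eq (p := fun q : ℕ × ℕ => q.2 % q.1 = 0)
    (Primrec.eq.comp (nat_mod.comp snd fst) (const 0)) fun _ => Nat.dvd_iff_mod_eq_zero.symm

theorem PrimrecRel.exists_mem_range {β : Type*} [Primcodable β] {R : ℕ → β → Prop}
    (hR : PrimrecRel R) : PrimrecRel fun n b => ∃ x < n, R x b :=
  PrimrecPred.of_eq (hR.exists_mem_list.comp (list_range.comp fst) snd) (by simp)

theorem PrimrecRel.forall_mem_range {β : Type*} [Primcodable β] {R : ℕ → β → Prop}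
    (hR : PrimrecRel R) : PrimrecRel fun n b => ∀ x < n, R x b :=
  PrimrecPred.of_eq (hR.forall_mem_list.comp (list_range.comp fst) snd) (by simp)

/-- For `b = (u, p, c)`: the local rule with code `c`, applied to the window at position `i` of the
word with code `u`, gives the `i`-th digit of `p`. -/
def CACode.CellCode (i : ℕ) (b : ℕ × ℕ × CACode) : Prop :=
  b.2.2.2.2[b.1 / b.2.2.1 ^ i % b.2.2.1 ^ (2 * b.2.2.2.1 + 1)]? =
    some (b.2.1 / b.2.2.1 ^ i % b.2.2.1)

theorem primrecRel_cellCode : PrimrecRel CACode.CellCode := by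
  have hc : Primrec fun q : ℕ × ℕ × ℕ × CACode => q.2.2.2 := snd.comp (snd.comp snd)
  have hu : Primrec fun q : ℕ × ℕ × ℕ × CACode => q.2.1 := fst.comp snd
  have hp : Primrec fun q : ℕ × ℕ × ℕ × CACode => q.2.2.1 := fst.comp (snd.comp snd)
  have hs : Primrec fun q : ℕ × ℕ × ℕ × CACode => q.2.2.2.1 := fst.comp hc
  have hr : Primrec fun q : ℕ × ℕ × ℕ × CACode => q.2.2.2.2.1 := fst.comp (snd.comp hc)
  have hT : Primrec fun q : ℕ × ℕ × ℕ × CACode => q.2.2.2.2.2 := snd.comp (snd.comp hc)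
  have hsi := primrec_pow.comp hs fst
  exact Primrec.eq.comp
    (list_getElem?.comp hT (nat_mod.comp (nat_div.comp hu hsi)
      (primrec_pow.comp hs (succ.comp (nat_mul.comp (const 2) hr)))))
    (option_some.comp (nat_mod.comp (nat_div.comp hp hsi) hs))

theorem primrecRel_wordCode : PrimrecRel fun (u : ℕ) (b : ℕ × CACode × ℕ) =>
    u / b.2.1.1 ^ b.2.2 = b.1 / b.2.1.1 ^ b.2.2 ∧
      ∀ i < b.2.2, CACode.CellCode i (u, b.1, b.2.1) := by
  have hc : Primrec fun q : ℕ × ℕ × CACode × ℕ => q.2.2.1 := fst.comp (snd.comp snd)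
  have hM : Primrec fun q : ℕ × ℕ × CACode × ℕ => q.2.2.2 := snd.comp (snd.comp snd)
  have hp : Primrec fun q : ℕ × ℕ × CACode × ℕ => q.2.1 := fst.comp snd
  have hsM := primrec_pow.comp (fst.comp hc) hM
  exact PrimrecPred.and (Primrec.eq.comp (nat_div.comp fst hsM) (nat_div.comp hp hsM))
    (primrecRel_cellCode.forall_mem_range.comp hM (fst.pair (hp.pair hc)))

theorem primrecRel_stairCode :
    PrimrecRel fun (p : ℕ) (a : CACode × ℕ) => a.1.StairCode a.2 p := by
  have hc : Primrec fun q : ℕ × CACode × ℕ => q.2.1 := fst.comp snd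
  have hM : Primrec fun q : ℕ × CACode × ℕ => q.2.2 := snd.comp snd
  have hn := primrec_pow.comp (fst.comp hc)
    (nat_add.comp hM (nat_mul.comp (const 2) (fst.comp (snd.comp hc))))
  exact PrimrecPred.of_eq (primrecRel_wordCode.exists_mem_range.comp hn Primrec.id)
    fun _ => Iff.rfl

theorem primrec_stairCount : Primrec₂ CACode.stairCount := by
  have hs : Primrec fun q : CACode × ℕ => q.1.1 := fst.comp fst
  have hr : Primrec fun q : CACode × ℕ => q.1.2.1 := fst.comp (snd.comp fst)
  exact list_length.comp (primrecRel_stairCode.listFilter.comp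
    (list_range.comp (primrec_pow.comp hs (nat_add.comp snd (nat_mul.comp (const 2) hr))))
    Primrec.id)

theorem primrecPred_sliderCondition : PrimrecPred CACode.SliderCondition := by
  have hs : Primrec fun c : CACode => c.1 := fst
  have hr : Primrec fun c : CACode => c.2.1 := fst.comp snd
  have hB := primrec_pow.comp hs (nat_mul.comp (const 4) hr)
  have hcount := primrec_stairCount.comp Primrec.id hB
  exact PrimrecPred.or (Primrec.eq.comp hs (const 0)) (PrimrecPred.and
    (Primrec.eq.comp (primrec_stairCount.comp Primrec.id (succ.comp hB))
      (nat_mul.comp hs hcount))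
    (primrecRel_dvd.comp hcount (primrec_pow.comp hs (nat_add.comp hB hr))))

end Computability

/-! ### The main theorem. -/

theorem mainTheorem6 :
    ∃ D : CACode → Bool, Computable D ∧
      ∀ (S : Type*) [Finite S] [TopologicalSpace S] [DiscreteTopology S]
        (f : Config S → Config S), IsCellularAutomaton f →
        (IsSlider f ↔ IsSweeper f) ∧
        ∀ c : CACode, c.Presents f →
          (D c = true ↔ IsSlider f) ∧ (D c = true ↔ IsSweeper f) := by
  refine ⟨fun c => decide c.SliderCondition, primrecPred_sliderCondition.decide.to_comp, ?_⟩
  intro S _ _ _ f hf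
  have h : IsSlider f ↔ IsSweeper f := by
    obtain ⟨r, loc, hloc⟩ := hf
    exact ⟨fun h => h.isSweeper (isSlidingMap_of_local hloc),
      fun h => h.isSlider (isSlidingMap_of_local hloc)⟩
  refine ⟨h, fun c hc => ?_⟩
  rw [decide_eq_true_iff, ← h]
  exact ⟨hc.sliderCondition_iff, hc.sliderCondition_iff⟩
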